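/- Let $(\Omega,\Sigma)$ be a measurable space and let $X$ be a real Banach space with dual $X^*$. Denote by $b(X)$ the family of all bounded non-empty subsets of $X$. For $x^*\in X^*$ and $C\in b(X)$ write $s(x^*,C):=\sup\{x^*(x): x\in C\}$. A map $M:\Sigma\to b(X)$ is called a multimeasure if, for each $x^*\in X^*$, the map $A\mapsto s(x^*,M(A))$ is a countably additive real-valued measure on $\Sigma$. A finite non-negative countably additive measure $\mu$ on $\Sigma$ is called a control measure of $M$ if $M(A)=\{0\}$ for every $A\in\Sigma$ with $\mu(A)=0$. Let $\omega_1$ be the first uncountable ordinal and let $c_0(\omega_1)$ be the Banach space of all $f:\omega_1\to\mathbb{R}$ such that $\{\alpha<\omega_1: |f(\alpha)|\ge\varepsilon\}$ is finite for every $\varepsilon>0$, equipped with the supremum norm. Suppose that $X$ contains no norm-closed linear subspace isomorphic (that is, linearly homeomorphic) to $c_0(\omega_1)$. Then every multimeasure $M:\Sigma\to b(X)$ admits a control measure. -/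

import Mathlib

open Filter Topology MeasureTheory
open scoped ENNReal

/-- `c₀(I)`: the bounded families `f : I → ℝ` that tend to `0` along the cofinite filter, i.e.
such that `{i | ε ≤ |f i|}` is finite for every `ε > 0`, as a linear subspace of `ℓ_∞(I)`, with
the supremum norm. -/
def cZero (I : Type*) : Submodule ℝ (lp (fun _ : I => ℝ) ∞) where
  carrier := {f | Tendsto (fun i => f i) cofinite (𝓝 0)}
  zero_mem' := by
    simpa using (tendsto_const_nhds : Tendsto (fun _ : I => (0 : ℝ)) cofinite (𝓝 0))
  add_mem' := by
    intro f g hf hg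
    simpa using Tendsto.add (show Tendsto (fun i => f i) cofinite (𝓝 0) from hf)
      (show Tendsto (fun i => g i) cofinite (𝓝 0) from hg)
  smul_mem' := by
    intro c f hf
    simpa using Tendsto.const_mul c (show Tendsto (fun i => f i) cofinite (𝓝 0) from hf)

/-- `X` contains a (norm-closed linear) subspace isomorphic, as a topological vector space, to the
Banach space `E`. -/
def ContainsIsomorphicCopy (E X : Type*) [NormedAddCommGroup E] [NormedSpace ℝ E]
    [NormedAddCommGroup X] [NormedSpace ℝ X] : Prop :=
  ∃ Y : Submodule ℝ X, IsClosed (Y : Set X) ∧ Nonempty (E ≃L[ℝ] Y)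

/-- `b(X)`: the family of all bounded non-empty subsets of `X`. -/
def BddNonempty (X : Type*) [NormedAddCommGroup X] : Type _ :=
  {C : Set X // Bornology.IsBounded C ∧ C.Nonempty}

/-- `s(x*, C) = sup {x*(x) : x ∈ C}`, for `x* ∈ X*` and `C ∈ b(X)`. -/
noncomputable def suppFun {X : Type*} [NormedAddCommGroup X] [NormedSpace ℝ X]
    (φ : StrongDual ℝ X) (C : BddNonempty X) : ℝ :=
  sSup ((fun x => φ x) '' C.1)

/-- A map `M : Σ → b(X)` is a multimeasure if, for every `x* ∈ X*`, the map `A ↦ s(x*, M(A))` is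
a countably additive real-valued measure on the `σ`-algebra `Σ`. -/
def IsMultimeasure {Ω X : Type*} [MeasurableSpace Ω] [NormedAddCommGroup X] [NormedSpace ℝ X]
    (M : {A : Set Ω // MeasurableSet A} → BddNonempty X) : Prop :=
  ∀ φ : StrongDual ℝ X, ∃ ν : SignedMeasure Ω,
    ∀ A : {A : Set Ω // MeasurableSet A}, ν A.1 = suppFun φ (M A)

/-- `μ` is a control measure of `M`: a finite non-negative measure such that `M(A) = {0}`
whenever `μ(A) = 0`. -/
def IsControlMeasure {Ω X : Type*} [MeasurableSpace Ω] [NormedAddCommGroup X]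
    (μ : Measure Ω) (M : {A : Set Ω // MeasurableSet A} → BddNonempty X) : Prop :=
  IsFiniteMeasure μ ∧
    ∀ A : {A : Set Ω // MeasurableSet A}, μ A.1 = 0 → (M A).1 = {0}

/-!
Write `ν_φ` for the signed measure `A ↦ s(φ, M A)` and call a measurable set charged if
`|ν_φ| A ≠ 0` for some `φ`. There are two cases.

If every disjoint family of charged sets is countable, an exhaustion argument shows that countably
many of the `|ν_φ|` dominate all the others (`exists_countable_dominating_of_ccc`); a finite
measure with the same null sets as their sum is a control measure, because a bounded nonempty set
whose support function vanishes is `{0}`.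

Otherwise there are uncountably many disjoint charged sets, hence disjoint sets `B_i`, `i < ω₁`, and
points `x_i ∈ M (B_i)` with `‖x_i‖ ≥ ε > 0`. Since `|φ (x_i)| ≤ |ν_φ (B_i)| + |ν_{-φ} (B_i)|`, the
finite sums `∑ |φ (x_i)|` are bounded by `|ν_φ| Ω + |ν_{-φ}| Ω` for each `φ`. By the uniform
boundedness principle, `e_i ↦ x_i` extends to a bounded operator `c₀(ω₁) → X`, and Rosenthal's
disjointness lemma (`exists_injective_sum_le`) yields a subfamily, still of cardinality `ℵ₁`, on
which this operator is bounded below (`containsIsomorphicCopy_cZero`). So `X` contains `c₀(ω₁)`.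
-/

/-! ### Domination of a family of measures under the countable chain condition -/

open Set in
theorem exists_maximal_pairwiseDisjoint {Ω : Type*} (P : Set Ω → Prop) :
    ∃ 𝒜 : Set (Set Ω), (∀ A ∈ 𝒜, P A) ∧ 𝒜.PairwiseDisjoint id ∧
      ∀ A, P A → (∀ B ∈ 𝒜, Disjoint A B) → A ∈ 𝒜 := by
  obtain ⟨𝒜, h𝒜⟩ := zorn_subset
    {𝒜 : Set (Set Ω) | (∀ A ∈ 𝒜, P A) ∧ 𝒜.PairwiseDisjoint id} (by
      refine fun c hc hchain => ⟨⋃₀ c, ⟨?_, ?_⟩, fun s hs => subset_sUnion_of_mem hs⟩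
      · rintro A ⟨s, hs, hA⟩
        exact (hc hs).1 A hA
      · exact (pairwiseDisjoint_sUnion hchain.directedOn).2 fun s hs => (hc hs).2)
  refine ⟨𝒜, h𝒜.prop.1, h𝒜.prop.2, fun A hA hdisj => ?_⟩
  refine h𝒜.le_of_ge (y := insert A 𝒜) ⟨?_, ?_⟩ (subset_insert _ _) (mem_insert _ _)
  · rintro B (rfl | hB)
    exacts [hA, h𝒜.prop.1 B hB]
  · exact h𝒜.prop.2.insert fun B hB _ => hdisj B hB

/-- If every disjoint family of sets charged by some `κ i` is countable, then `κ` is dominated by a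
countable subfamily. Every charged set contains a charged set `B` on which a single `κ i` dominates
all the others; a maximal disjoint family of such sets `B` is countable, and the corresponding
indices `i` suffice. -/
theorem exists_countable_dominating_of_ccc {Ω ι : Type*} [MeasurableSpace Ω]
    (κ : ι → Measure Ω)
    (hccc : ∀ 𝒜 : Set (Set Ω), (∀ A ∈ 𝒜, MeasurableSet A ∧ ∃ i, κ i A ≠ 0) →
      𝒜.PairwiseDisjoint id → 𝒜.Countable) :
    ∃ S : Set ι, S.Countable ∧
      ∀ A, MeasurableSet A → (∀ i ∈ S, κ i A = 0) → ∀ i, κ i A = 0 := by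
  rcases isEmpty_or_nonempty ι with hι | hι
  · exact ⟨∅, Set.countable_empty, fun _ _ _ i => hι.elim i⟩
  have hgood : ∀ A, MeasurableSet A → (∃ i, κ i A ≠ 0) → ∃ B ⊆ A, MeasurableSet B ∧
      ∃ i, κ i B ≠ 0 ∧ ∀ C ⊆ B, MeasurableSet C → κ i C = 0 → ∀ j, κ j C = 0 := by
    rintro A hA ⟨i, hi⟩
    -- Remove from `A` a maximal disjoint family of `κ i`-null sets that some `κ j` charges.
    obtain ⟨𝒜, h𝒜, hdisj, hmax⟩ := exists_maximal_pairwiseDisjoint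
      fun C : Set Ω => C ⊆ A ∧ MeasurableSet C ∧ κ i C = 0 ∧ ∃ j, κ j C ≠ 0
    have hcount : 𝒜.Countable :=
      hccc 𝒜 (fun C hC => ⟨(h𝒜 C hC).2.1, (h𝒜 C hC).2.2.2⟩) hdisj
    have hU : MeasurableSet (⋃₀ 𝒜) := .sUnion hcount fun C hC => (h𝒜 C hC).2.1
    have hU0 : κ i (⋃₀ 𝒜) = 0 :=
      (measure_sUnion_null_iff hcount).2 fun C hC => (h𝒜 C hC).2.2.1
    refine ⟨A \ ⋃₀ 𝒜, Set.sdiff_subset, hA.diff hU, i, by rwa [measure_sdiff_null hU0],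
      fun C hC hCm hC0 => ?_⟩
    by_contra! hne
    have hCd : ∀ B ∈ 𝒜, Disjoint C B := fun B hB =>
      Set.disjoint_left.2 fun x hx hxB => (hC hx).2 ⟨B, hB, hxB⟩
    have hC𝒜 := hmax C ⟨hC.trans Set.sdiff_subset, hCm, hC0, hne⟩ hCd
    obtain ⟨j, hj⟩ := hne
    exact hj (by simp [disjoint_self.1 (hCd C hC𝒜)])
  obtain ⟨𝒜, h𝒜, hdisj, hmax⟩ := exists_maximal_pairwiseDisjoint fun B : Set Ω =>
    MeasurableSet B ∧ ∃ i, κ i B ≠ 0 ∧ ∀ C ⊆ B, MeasurableSet C → κ i C = 0 → ∀ j, κ j C = 0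
  have hcount : 𝒜.Countable :=
    hccc 𝒜 (fun C hC => ⟨(h𝒜 C hC).1, (h𝒜 C hC).2.imp fun _ h => h.1⟩) hdisj
  choose! hm k hk0 hk using h𝒜
  refine ⟨k '' 𝒜, hcount.image k, fun A hA hA0 => ?_⟩
  have hin : ∀ B ∈ 𝒜, ∀ j, κ j (A ∩ B) = 0 := fun B hB =>
    hk B hB _ Set.inter_subset_right (hA.inter (hm B hB))
      (measure_mono_null Set.inter_subset_left (hA0 _ ⟨B, hB, rfl⟩))
  have hout : ∀ j, κ j (A \ ⋃₀ 𝒜) = 0 := by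
    by_contra! hne
    obtain ⟨B, hBA, hBm, i, hi, hB⟩ := hgood _ (hA.diff (.sUnion hcount hm)) hne
    have hBd : ∀ C ∈ 𝒜, Disjoint B C := fun C hC =>
      Set.disjoint_left.2 fun x hx hxC => (hBA hx).2 ⟨C, hC, hxC⟩
    have hB𝒜 := hmax B ⟨hBm, i, hi, hB⟩ hBd
    exact hi (by simp [disjoint_self.1 (hBd B hB𝒜)])
  intro j
  rw [← Set.inter_union_sdiff A (⋃₀ 𝒜), Set.sUnion_eq_biUnion, Set.inter_iUnion₂]
  refine measure_union_null ((measure_biUnion_null_iff hcount).2 fun B hB => hin B hB j) ?_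
  rw [← Set.sUnion_eq_biUnion]
  exact hout j

theorem exists_isFiniteMeasure_dominating {Ω ι : Type*} [MeasurableSpace Ω]
    (κ : ι → Measure Ω) [∀ i, IsFiniteMeasure (κ i)] {S : Set ι} (hS : S.Countable) :
    ∃ μ : Measure Ω, IsFiniteMeasure μ ∧ ∀ i ∈ S, κ i ≪ μ := by
  have := hS.to_subtype
  refine ⟨(Measure.sum fun i : S => κ i).toFinite, inferInstance, fun i hi => ?_⟩
  exact (Measure.le_sum (fun i : S => κ i) ⟨i, hi⟩).absolutelyContinuous.trans
    (absolutelyContinuous_toFinite _)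

/-! ### Total variation of a signed measure -/

theorem abs_le_totalVariation_real {Ω : Type*} [MeasurableSpace Ω] (ν : SignedMeasure Ω)
    {A : Set Ω} (hA : MeasurableSet A) : |ν A| ≤ ν.totalVariation.real A := by
  rw [ν.apply_eq_posPart_real_sub_negPart_real hA, SignedMeasure.totalVariation,
    measureReal_add_apply]
  have h₁ := measureReal_nonneg (μ := ν.toJordanDecomposition.posPart) (s := A)
  have h₂ := measureReal_nonneg (μ := ν.toJordanDecomposition.negPart) (s := A)
  exact abs_sub_le_iff.2 ⟨by linarith, by linarith⟩

theorem exists_subset_ne_zero_of_totalVariation_ne_zero {Ω : Type*} [MeasurableSpace Ω]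
    (ν : SignedMeasure Ω) {A : Set Ω} (hA : MeasurableSet A) (h : ν.totalVariation A ≠ 0) :
    ∃ B ⊆ A, MeasurableSet B ∧ ν B ≠ 0 := by
  contrapose! h
  obtain ⟨i, hi₁, hi₂, hi₃, hpos, hneg⟩ := ν.toJordanDecomposition_spec
  rw [SignedMeasure.totalVariation, Measure.add_apply, hpos, hneg,
    SignedMeasure.toMeasureOfZeroLE_apply _ _ _ hA, SignedMeasure.toMeasureOfLEZero_apply _ _ _ hA]
  simp [h _ Set.inter_subset_right (hi₁.inter hA),
    h _ Set.inter_subset_right (hi₁.compl.inter hA)]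

/-! ### Isomorphic copies of `c₀(I)` -/

/-- Rosenthal's disjointness lemma: a matrix whose off-diagonal row sums are uniformly bounded has
a submatrix of full cardinality with small off-diagonal row sums. Split `I` into `#I` pieces of
cardinality `#I`. Either some piece works, or each piece contains a row whose sum over the rest of
that piece exceeds `δ`; these rows, one from each piece, form a submatrix whose off-diagonal row sums
have dropped by `δ`, and this can happen only `n` times. -/
theorem exists_injective_sum_le {I : Type*} [Infinite I] {δ : ℝ} (n : ℕ)
    (a : I → I → ℝ)
    (hsum : ∀ i, ∀ F : Finset I, i ∉ F → ∑ j ∈ F, a i j ≤ n * δ) (hδ : 0 ≤ δ) :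
    ∃ e : I → I, Function.Injective e ∧
      ∀ i, ∀ F : Finset I, i ∉ F → ∑ j ∈ F, a (e i) (e j) ≤ δ := by
  classical
  induction n generalizing a with
  | zero => exact ⟨id, Function.injective_id, fun i F hF => (hsum i F hF).trans (by simpa)⟩
  | succ n ih =>
    obtain ⟨g⟩ : Nonempty (I × I ≃ I) := by
      rw [← Cardinal.eq, Cardinal.mk_prod, Cardinal.lift_id,
        Cardinal.mul_eq_self (Cardinal.aleph0_le_mk I)]
    by_cases hgood : ∃ ξ, ∀ i, ∀ F : Finset I, i ∉ F → ∑ j ∈ F, a (g (ξ, i)) (g (ξ, j)) ≤ δ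
    · obtain ⟨ξ, hξ⟩ := hgood
      exact ⟨fun i => g (ξ, i), fun i j h => by simpa using h, hξ⟩
    · push Not at hgood
      choose η F hηF hF using hgood
      have hinj : Function.Injective fun ξ => g (ξ, η ξ) := fun ξ ξ' h =>
        congrArg Prod.fst (g.injective h)
      obtain ⟨e, he, hes⟩ := ih (fun ξ ξ' => a (g (ξ, η ξ)) (g (ξ', η ξ'))) (by
        intro ξ G hG
        have hd : Disjoint (G.image fun ξ' => g (ξ', η ξ')) ((F ξ).image fun j => g (ξ, j)) := by
          rw [Finset.disjoint_left]
          intro x hx hx'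
          obtain ⟨ξ', h', rfl⟩ := Finset.mem_image.1 hx
          obtain ⟨j, hj, hjx⟩ := Finset.mem_image.1 hx'
          have := congrArg Prod.fst (g.injective hjx)
          exact hG ((show ξ = ξ' from this) ▸ h')
        -- The sum over `G` and the excess over `F ξ` share the original row bound.
        have h := hsum (g (ξ, η ξ))
            ((G.image fun ξ' => g (ξ', η ξ')) ∪ (F ξ).image fun j => g (ξ, j)) (by
          intro hmem
          rcases Finset.mem_union.1 hmem with hmem | hmem
          · obtain ⟨ξ', h', hx⟩ := Finset.mem_image.1 hmem
            exact hG ((hinj hx) ▸ h')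
          · obtain ⟨j, hj, hx⟩ := Finset.mem_image.1 hmem
            have := congrArg Prod.snd (g.injective hx)
            exact hηF ξ ((show j = η ξ from this) ▸ hj))
        rw [Finset.sum_union hd, Finset.sum_image hinj.injOn,
          Finset.sum_image fun i _ j _ h => by simpa using h] at h
        have := hF ξ
        push_cast at h
        linarith)
      exact ⟨fun i => g (e i, η (e i)), hinj.comp he, hes⟩

theorem isClosed_cZero (I : Type*) : IsClosed (cZero I : Set (lp (fun _ : I => ℝ) ∞)) := by
  refine isClosed_of_closure_subset fun f hf => ?_
  show Tendsto (fun i => f i) cofinite (𝓝 0)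
  rw [Metric.tendsto_nhds]
  intro ε hε
  obtain ⟨g, hg, hfg⟩ := Metric.mem_closure_iff.1 hf (ε / 2) (half_pos hε)
  have hg' : Tendsto (fun i => g i) cofinite (𝓝 0) := hg
  filter_upwards [Metric.tendsto_nhds.1 hg' (ε / 2) (half_pos hε)] with i hi
  have h := lp.norm_apply_le_norm ENNReal.top_ne_zero (f - g) i
  rw [dist_eq_norm] at hfg
  rw [dist_zero_right] at hi ⊢
  have : f i = (f - g) i + g i := by simp
  rw [this]
  exact (norm_add_le _ _).trans_lt (by linarith)

/-- The Banach–Steinhaus theorem, applied in the bidual to the finite sums `∑ aᵢ xᵢ` with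
`|aᵢ| ≤ 1`: a family that is weakly absolutely summable, in the sense that the finite sums of
`|φ (xᵢ)|` are bounded for each `φ`, satisfies an upper `c₀`-estimate. -/
theorem exists_norm_sum_smul_le {I X : Type*} [NormedAddCommGroup X] [NormedSpace ℝ X]
    (x : I → X) (hx : ∀ φ : StrongDual ℝ X, ∃ C, ∀ F : Finset I, ∑ i ∈ F, |φ (x i)| ≤ C) :
    ∃ C, ∀ (F : Finset I) (a : I → ℝ) (r : ℝ), 0 ≤ r → (∀ i ∈ F, |a i| ≤ r) →
      ‖∑ i ∈ F, a i • x i‖ ≤ C * r := by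
  obtain ⟨C, hC⟩ := banach_steinhaus
    (g := fun p : {p : Finset I × (I → ℝ) // ∀ i ∈ p.1, |p.2 i| ≤ 1} =>
      NormedSpace.inclusionInDoubleDual ℝ X (∑ i ∈ p.1.1, p.1.2 i • x i)) (by
    intro φ
    obtain ⟨C, hC⟩ := hx φ
    refine ⟨C, fun p => le_trans ?_ (hC p.1.1)⟩
    rw [NormedSpace.dual_def, map_sum]
    refine (Finset.abs_sum_le_sum_abs _ _).trans (Finset.sum_le_sum fun i hi => ?_)
    rw [map_smul, smul_eq_mul, abs_mul]
    exact mul_le_of_le_one_left (abs_nonneg _) (p.2 i hi))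
  refine ⟨C, fun F a r hr ha => ?_⟩
  rcases hr.eq_or_lt with rfl | hr
  · rw [Finset.sum_eq_zero fun i hi => ?_]
    · simp
    · rw [abs_nonpos_iff.1 (ha i hi), zero_smul]
  · have h := hC ⟨(F, fun i => a i / r), fun i hi => by
      rw [abs_div, abs_of_pos hr]; exact (div_le_one hr).2 (ha i hi)⟩
    replace h : ‖∑ i ∈ F, (a i / r) • x i‖ ≤ C :=
      ((NormedSpace.inclusionInDoubleDualLi ℝ).norm_map _).symm.trans_le h
    have : ∑ i ∈ F, a i • x i = r • ∑ i ∈ F, (a i / r) • x i := by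
      rw [Finset.smul_sum]
      refine Finset.sum_congr rfl fun i _ => ?_
      rw [smul_smul, mul_div_cancel₀ _ hr.ne']
    rw [this, norm_smul, Real.norm_of_nonneg hr.le, mul_comm]
    exact mul_le_mul_of_nonneg_right h hr.le

/-- Upper and lower estimates for finite sums give an isomorphic embedding of `c₀(I)`. The lower
estimate says that the `i`-th term contributes at least `2 * c * |a i|` and the other terms cancel
at most `c * r`; for `r = ‖f‖` and the supremum over `i` it becomes `c * ‖f‖ ≤ ‖T f‖`. -/
theorem containsIsomorphicCopy_cZero_of_bounds {I X : Type*} [NormedAddCommGroup X]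
    [NormedSpace ℝ X] [CompleteSpace X] (y : I → X) {c C : ℝ} (hc : 0 < c)
    (hupper : ∀ (F : Finset I) (a : I → ℝ) (r : ℝ), 0 ≤ r → (∀ i ∈ F, |a i| ≤ r) →
      ‖∑ i ∈ F, a i • y i‖ ≤ C * r)
    (hlower : ∀ (F : Finset I) (a : I → ℝ) (r : ℝ), 0 ≤ r → (∀ i ∈ F, |a i| ≤ r) →
      ∀ i ∈ F, |a i| * (2 * c) - c * r ≤ ‖∑ i ∈ F, a i • y i‖) :
    ContainsIsomorphicCopy (cZero I) X := by
  have hsummable : ∀ f : cZero I, Summable fun i => f.1 i • y i := by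
    intro f
    rw [summable_iff_vanishing_norm]
    intro ε hε
    have hr : 0 < ε / (2 * (|C| + 1)) := by positivity
    have hf : Tendsto (fun i => f.1 i) cofinite (𝓝 0) := f.2
    have hfin := Metric.tendsto_nhds.1 hf _ hr
    rw [eventually_cofinite] at hfin
    refine ⟨hfin.toFinset, fun F hF => ?_⟩
    refine (hupper F (fun i => f.1 i) _ hr.le fun i hi => ?_).trans_lt ?_
    · have := Finset.disjoint_left.1 hF hi
      simp only [Set.Finite.mem_toFinset, Set.mem_ofPred_eq, not_not, dist_zero_right] at this
      exact this.le
    · have : C * (ε / (2 * (|C| + 1))) ≤ (|C| + 1) * (ε / (2 * (|C| + 1))) :=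
        mul_le_mul_of_nonneg_right (by linarith [le_abs_self C]) hr.le
      have h2 : (|C| + 1) * (ε / (2 * (|C| + 1))) = ε / 2 := by
        field_simp
      linarith
  let T : cZero I →ₗ[ℝ] X :=
    { toFun := fun f => ∑' i, f.1 i • y i
      map_add' := fun f g => by
        rw [← (hsummable f).tsum_add (hsummable g)]
        exact tsum_congr fun i => by simp [add_smul]
      map_smul' := fun r f => by
        simp only [RingHom.id_apply]
        rw [← (hsummable f).tsum_const_smul]
        exact tsum_congr fun i => by simp [mul_smul] }
  have hle : ∀ (f : cZero I) i, |f.1 i| ≤ ‖f‖ := fun f i =>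
    lp.norm_apply_le_norm ENNReal.top_ne_zero f.1 i
  have hT : ∀ f, ‖T f‖ ≤ C * ‖f‖ := fun f =>
    le_of_tendsto (hsummable f).hasSum.norm <| Eventually.of_forall fun F =>
      hupper F (fun i => f.1 i) _ (norm_nonneg _) fun i _ => hle f i
  have hT' : ∀ f, c * ‖f‖ ≤ ‖T f‖ := by
    intro f
    have h : ∀ i, |f.1 i| ≤ (‖T f‖ + c * ‖f‖) / (2 * c) := by
      intro i
      rw [le_div_iff₀ (by positivity)]
      have : |f.1 i| * (2 * c) - c * ‖f‖ ≤ ‖T f‖ :=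
        ge_of_tendsto (hsummable f).hasSum.norm <|
          (eventually_ge_atTop {i}).mono fun F hF =>
            hlower F (fun i => f.1 i) _ (norm_nonneg _) (fun i _ => hle f i) i
              (hF (Finset.mem_singleton_self i))
      linarith
    have h0 : 0 ≤ (‖T f‖ + c * ‖f‖) / (2 * c) := by positivity
    have hf : ‖f‖ ≤ (‖T f‖ + c * ‖f‖) / (2 * c) := lp.norm_le_of_forall_le h0 h
    rw [le_div_iff₀ (by positivity)] at hf
    linarith
  have hanti : AntilipschitzWith (Real.toNNReal c⁻¹) T :=
    AddMonoidHomClass.antilipschitz_of_bound T fun f => by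
      rw [Real.coe_toNNReal _ (inv_nonneg.2 hc.le), inv_mul_eq_div, le_div_iff₀ hc, mul_comm]
      exact hT' f
  have : CompleteSpace (cZero I) := (isClosed_cZero I).completeSpace_coe
  have hclosed : IsClosed (LinearMap.range T : Set X) := by
    rw [LinearMap.coe_range]
    exact hanti.isClosed_range (T.mkContinuous C hT).uniformContinuous
  refine ⟨LinearMap.range T, hclosed, ⟨(LinearEquiv.ofInjective T
    hanti.injective).toContinuousLinearEquivOfBounds C c⁻¹ hT fun v => ?_⟩⟩
  obtain ⟨f, rfl⟩ := (LinearEquiv.ofInjective T hanti.injective).surjective v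
  rw [LinearEquiv.symm_apply_apply, inv_mul_eq_div, le_div_iff₀ hc, mul_comm]
  exact hT' f

/-- Rosenthal's theorem: if `e_i ↦ x i` defines a bounded operator on `c₀(I)` and the `x i` are
bounded away from `0`, then some restriction of this operator to `c₀(J)` with `J ⊆ I` of full
cardinality is an isomorphism onto its range. -/
theorem containsIsomorphicCopy_cZero {I X : Type*} [Infinite I] [NormedAddCommGroup X]
    [NormedSpace ℝ X] [CompleteSpace X] (x : I → X) {ε : ℝ} (hε : 0 < ε)
    (hxε : ∀ i, ε ≤ ‖x i‖)
    (hx : ∀ φ : StrongDual ℝ X, ∃ C, ∀ F : Finset I, ∑ i ∈ F, |φ (x i)| ≤ C) :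
    ContainsIsomorphicCopy (cZero I) X := by
  classical
  obtain ⟨C, hC⟩ := exists_norm_sum_smul_le x hx
  have hx0 : ∀ i, x i ≠ 0 := fun i => norm_pos_iff.1 (hε.trans_le (hxε i))
  choose φ hφ hφx using fun i => exists_dual_vector ℝ (x i) (norm_ne_zero_iff.2 (hx0 i))
  have hrow : ∀ i, ∀ F : Finset I, ∑ j ∈ F, |φ i (x j)| ≤ C := by
    intro i F
    have hsign : ∀ t : ℝ, |(SignType.sign t : ℝ)| ≤ 1 := fun t => by
      rcases lt_trichotomy t 0 with h | h | h <;> simp [h]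
    -- Signs as coefficients turn the upper estimate into a bound on the absolute row sum.
    have h := hC F (fun j => SignType.sign (φ i (x j))) 1 zero_le_one fun j _ => hsign _
    have h' := (φ i).le_of_opNorm_le (hφ i).le (∑ j ∈ F, (SignType.sign (φ i (x j)) : ℝ) • x j)
    rw [map_sum] at h'
    simp only [map_smul, smul_eq_mul, sign_mul_self] at h'
    have := (le_abs_self _).trans h'
    linarith
  obtain ⟨n, hn⟩ := exists_nat_ge (C / (ε / 2))
  obtain ⟨e, he, hsum⟩ := exists_injective_sum_le n (δ := ε / 2) (fun i j => |φ i (x j)|)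
    (fun i F _ => (hrow i F).trans ((div_le_iff₀ (half_pos hε)).1 hn)) (half_pos hε).le
  refine containsIsomorphicCopy_cZero_of_bounds (x ∘ e) (c := ε / 2) (C := C) (half_pos hε) ?_ ?_
  · intro F a r hr ha
    have h := hC (F.image e) (Function.extend e a 0) r hr (by
      intro i hi
      obtain ⟨j, hj, rfl⟩ := Finset.mem_image.1 hi
      rw [he.extend_apply]
      exact ha j hj)
    rw [Finset.sum_image he.injOn] at h
    simpa [he.extend_apply] using h
  · intro F a r hr ha i hi
    -- Test the sum against the functional norming `x (e i)`.
    have h := (φ (e i)).le_of_opNorm_le (hφ (e i)).le (∑ j ∈ F, a j • (x ∘ e) j)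
    rw [← Finset.add_sum_erase F _ hi, map_add, map_sum] at h
    simp only [Function.comp_apply, map_smul, smul_eq_mul, hφx, RCLike.ofReal_real_eq_id,
      id_eq, one_mul, Real.norm_eq_abs] at h
    rw [← Finset.add_sum_erase F _ hi]
    have h2 : |∑ j ∈ F.erase i, a j * φ (e i) (x (e j))| ≤ ε / 2 * r := by
      calc _ ≤ ∑ j ∈ F.erase i, |a j * φ (e i) (x (e j))| := Finset.abs_sum_le_sum_abs _ _
        _ ≤ ∑ j ∈ F.erase i, |φ (e i) (x (e j))| * r := Finset.sum_le_sum fun j hj => by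
            rw [abs_mul, mul_comm]
            exact mul_le_mul_of_nonneg_left (ha j (Finset.mem_of_mem_erase hj)) (abs_nonneg _)
        _ = (∑ j ∈ F.erase i, |φ (e i) (x (e j))|) * r := (Finset.sum_mul _ _ _).symm
        _ ≤ ε / 2 * r :=
            mul_le_mul_of_nonneg_right (hsum i _ (Finset.notMem_erase i F)) hr
    have h3 : |a i| * ε ≤ |a i * ‖x (e i)‖| := by
      rw [abs_mul, abs_norm]
      exact mul_le_mul_of_nonneg_left (hxε _) (abs_nonneg _)
    have h4 := abs_sub_abs_le_abs_add (a i * ‖x (e i)‖) (∑ j ∈ F.erase i, a j * φ (e i) (x (e j)))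
    simp only [Function.comp_apply]
    linarith

/-! ### Uncountable sets -/

theorem exists_uncountable_le {α : Type*} {s : Set α} (hs : ¬ s.Countable) (f : α → ℝ)
    (hf : ∀ a ∈ s, 0 < f a) : ∃ ε > 0, ¬ {a ∈ s | ε ≤ f a}.Countable := by
  by_contra! h
  refine hs ((Set.countable_iUnion fun n : ℕ => h (1 / (n + 1)) Nat.one_div_pos_of_nat).mono
    fun a ha => ?_)
  obtain ⟨n, hn⟩ := exists_nat_one_div_lt (hf a ha)
  exact Set.mem_iUnion.2 ⟨n, ha, hn.le⟩

theorem exists_injective_omega_one {α : Type*} {s : Set α} (hs : ¬ s.Countable) :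
    ∃ g : (Ordinal.omega.{0} 1).ToType → α, Function.Injective g ∧ ∀ i, g i ∈ s := by
  have : Uncountable s := by rwa [← Set.countable_coe_iff, not_countable_iff] at hs
  have hle : Cardinal.lift.{_, 0} (Cardinal.mk (Ordinal.omega.{0} 1).ToType) ≤
      Cardinal.lift.{0} (Cardinal.mk s) := by
    rw [Cardinal.mk_toType, Ordinal.card_omega, Cardinal.lift_aleph, Ordinal.lift_one,
      Cardinal.lift_uzero]
    exact Cardinal.aleph_one_le_iff.2 Cardinal.aleph0_lt_mk
  obtain ⟨g⟩ := Cardinal.lift_mk_le'.1 hle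
  exact ⟨fun i => g i, Subtype.val_injective.comp g.injective, fun i => (g i).2⟩

/-! ### Support functions and the control measure -/

theorem suppFun_singleton_zero {X : Type*} [NormedAddCommGroup X] [NormedSpace ℝ X]
    (φ : StrongDual ℝ X) {C : BddNonempty X} (hC : C.1 = {0}) : suppFun φ C = 0 := by
  simp [suppFun, hC]

theorem le_suppFun {X : Type*} [NormedAddCommGroup X] [NormedSpace ℝ X]
    (φ : StrongDual ℝ X) (C : BddNonempty X) {x : X} (hx : x ∈ C.1) : φ x ≤ suppFun φ C :=
  le_csSup (φ.lipschitz.isBounded_image C.2.1).bddAbove ⟨x, hx, rfl⟩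

theorem abs_le_abs_suppFun_add {X : Type*} [NormedAddCommGroup X] [NormedSpace ℝ X]
    (φ : StrongDual ℝ X) (C : BddNonempty X) {x : X} (hx : x ∈ C.1) :
    |φ x| ≤ |suppFun φ C| + |suppFun (-φ) C| := by
  have h₁ := le_suppFun φ C hx
  have h₂ := le_suppFun (-φ) C hx
  rw [neg_apply] at h₂
  have h₃ := le_abs_self (suppFun φ C)
  have h₄ := le_abs_self (suppFun (-φ) C)
  exact abs_le.2 ⟨by linarith [abs_nonneg (suppFun φ C)],
    by linarith [abs_nonneg (suppFun (-φ) C)]⟩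

theorem eq_singleton_zero_of_suppFun {X : Type*} [NormedAddCommGroup X] [NormedSpace ℝ X]
    (C : BddNonempty X) (hC : ∀ φ : StrongDual ℝ X, suppFun φ C = 0) : C.1 = {0} := by
  refine Set.eq_singleton_iff_nonempty_unique_mem.2 ⟨C.2.2, fun x hx => ?_⟩
  refine SeparatingDual.eq_zero_of_forall_dual_eq_zero (R := ℝ) fun φ => ?_
  simpa [hC] using abs_le_abs_suppFun_add φ C hx

theorem corollary1p3 {Ω X : Type*} [MeasurableSpace Ω]
    [NormedAddCommGroup X] [NormedSpace ℝ X] [CompleteSpace X]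
    (hX : ¬ ContainsIsomorphicCopy (cZero (Ordinal.omega.{0} 1).ToType) X)
    (M : {A : Set Ω // MeasurableSet A} → BddNonempty X) (hM : IsMultimeasure M) :
    ∃ μ : Measure Ω, IsControlMeasure μ M := by
  choose ν hν using hM
  have hfin : ∀ φ, IsFiniteMeasure (ν φ).totalVariation := fun φ => by
    unfold SignedMeasure.totalVariation; infer_instance
  by_cases hccc : ∀ 𝒜 : Set (Set Ω),
      (∀ A ∈ 𝒜, MeasurableSet A ∧ ∃ φ, (ν φ).totalVariation A ≠ 0) →
      𝒜.PairwiseDisjoint id → 𝒜.Countable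
  · obtain ⟨S, hS, hdom⟩ := exists_countable_dominating_of_ccc _ hccc
    obtain ⟨μ, hμ, hac⟩ := exists_isFiniteMeasure_dominating (fun φ => (ν φ).totalVariation) hS
    refine ⟨μ, hμ, fun A hA => eq_singleton_zero_of_suppFun _ fun φ => ?_⟩
    rw [← hν]
    exact (ν φ).null_of_totalVariation_zero (hdom A A.2 (fun ψ hψ => hac ψ hψ hA) φ)
  · refine absurd ?_ hX
    push Not at hccc
    obtain ⟨𝒜, h𝒜, hdisj, hunc⟩ := hccc
    have hex : ∀ A ∈ 𝒜, ∃ (B : {B : Set Ω // MeasurableSet B}) (x : X),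
        B.1 ⊆ A ∧ x ∈ (M B).1 ∧ 0 < ‖x‖ := by
      intro A hA
      obtain ⟨hAm, φ, hφ⟩ := h𝒜 A hA
      obtain ⟨B, hBA, hB, hνB⟩ := exists_subset_ne_zero_of_totalVariation_ne_zero _ hAm hφ
      by_contra! hcon
      refine hνB ?_
      rw [hν φ ⟨B, hB⟩]
      exact suppFun_singleton_zero φ (Set.eq_singleton_iff_nonempty_unique_mem.2 ⟨(M ⟨B, hB⟩).2.2,
        fun x hx => norm_le_zero_iff.1 (hcon ⟨B, hB⟩ x hBA hx)⟩)
    have : Nonempty {B : Set Ω // MeasurableSet B} := ⟨⟨∅, .empty⟩⟩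
    choose! B x hBA hxB hx0 using hex
    obtain ⟨ε, hε, hunc'⟩ := exists_uncountable_le hunc (fun A => ‖x A‖) hx0
    obtain ⟨g, hg, hgmem⟩ := exists_injective_omega_one hunc'
    have : Infinite (Ordinal.omega.{0} 1).ToType := by
      rw [Cardinal.infinite_iff, Cardinal.mk_toType, Ordinal.card_omega]
      exact Cardinal.aleph0_le_aleph 1
    refine containsIsomorphicCopy_cZero (x ∘ g) hε (fun i => (hgmem i).2) fun φ =>
      ⟨(ν φ).totalVariation.real Set.univ + (ν (-φ)).totalVariation.real Set.univ, fun F => ?_⟩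
    have hvar : ∀ ψ, ∑ i ∈ F, |suppFun ψ (M (B (g i)))| ≤ (ν ψ).totalVariation.real Set.univ := by
      intro ψ
      have hd : Set.PairwiseDisjoint (F : Set _) fun i => (B (g i)).1 := fun i _ j _ hij =>
        (hdisj (hgmem i).1 (hgmem j).1 (hg.ne hij)).mono (hBA _ (hgmem i).1) (hBA _ (hgmem j).1)
      calc _ ≤ ∑ i ∈ F, (ν ψ).totalVariation.real (B (g i)).1 :=
            Finset.sum_le_sum fun i _ => by
              rw [← hν]
              exact abs_le_totalVariation_real _ (B (g i)).2
        _ = (ν ψ).totalVariation.real (⋃ i ∈ F, (B (g i)).1) :=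
            (measureReal_biUnion_finset hd fun i _ => (B (g i)).2).symm
        _ ≤ _ := measureReal_mono (Set.subset_univ _)
    refine (Finset.sum_le_sum fun i _ =>
      abs_le_abs_suppFun_add φ (M (B (g i))) (hxB _ (hgmem i).1)).trans ?_
    rw [Finset.sum_add_distrib]
    exact add_le_add (hvar φ) (hvar (-φ))
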